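/- Graphs are finite, undirected and may have parallel edges; $\operatorname{cap}(u,v)$ denotes the number of edges between $u$ and $v$, and for a set $C\subseteq V$ of vertices $\operatorname{cap}(C,V\setminus C)$ denotes the number of edges with exactly one endpoint in $C$. A demand is a function $d:V\to\mathbb{R}$ with $\sum_{v\in V} d(v)=0$; write $d(C)=\sum_{v\in C}d(v)$. A flow is a function $f:V\times V\to\mathbb{R}$ with $f(u,v)=-f(v,u)$ for all $u,v$, and $f(u,v)=0$ whenever there is no edge between $u$ and $v$; it routes $d$ if $\sum_{v}f(u,v)=d(u)$ for every $u\in V$, and it has congestion $\alpha$ if $|f(u,v)|\le\alpha\cdot\operatorname{cap}(u,v)$ for all $u,v$. For $\alpha\ge 1$, a collection $\mathcal{C}$ of subsets of $V$ is an $\alpha$-congestion approximator for $G=(V,E)$ (has approximation guarantee $\alpha$) if every demand $d$ with $|d(C)|\le\operatorname{cap}(C,V\setminus C)$ for all $C\in\mathcal{C}$ can be routed in $G$ by a flow with congestion $\alpha$. It is hierarchical if $\mathcal{C}$ is laminar, that is, any two of its members are nested or disjoint. Observation. In the worst case, the approximation guarantee of every hierarchical congestion approximator is $\Omega(\log n)$: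 there is an absolute constant $c>0$ such that for every $n\ge 1$ there is a connected graph $G$ with $n$ vertices such that, whenever a laminar family $\mathcal{C}$ of subsets of $V(G)$ is an $\alpha$-congestion approximator for $G$, then $\alpha\ge c\log n$. -/

import Mathlib

/-- A finite undirected graph with parallel edges (and no self-loops) on the vertex set `V`,
given by the number `cap u v` of parallel edges between `u` and `v`. -/
structure CapGraph (V : Type*) where
  cap : V → V → ℕ
  cap_symm : ∀ u v, cap u v = cap v u
  cap_self : ∀ v, cap v v = 0

namespace CapGraph

/-- The simple graph obtained by merging parallel edges. -/
def toSimple {V : Type*} (G : CapGraph V) : SimpleGraph V where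
  Adj u v := 0 < G.cap u v
  symm := ⟨fun u v h => by rw [G.cap_symm v u]; exact h⟩
  loopless := ⟨fun v h => by rw [G.cap_self v] at h; exact lt_irrefl 0 h⟩

def IsConnected {V : Type*} (G : CapGraph V) : Prop :=
  G.toSimple.Connected

/-- The capacity of the cut `C`: the number of edges with exactly one endpoint in `C`. -/
def cutCap {V : Type*} [Fintype V] [DecidableEq V] (G : CapGraph V) (C : Finset V) : ℕ :=
  ∑ u ∈ C, ∑ v ∈ Cᶜ, G.cap u v

/-- `f u v` is the (signed) amount of flow sent from `u` to `v`. -/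
structure IsFlow {V : Type*} (G : CapGraph V) (f : V → V → ℝ) : Prop where
  antisymm : ∀ u v, f u v = -f v u
  support : ∀ u v, G.cap u v = 0 → f u v = 0

def HasCongestion {V : Type*} (G : CapGraph V) (f : V → V → ℝ) (c : ℝ) : Prop :=
  ∀ u v, |f u v| ≤ c * (G.cap u v : ℝ)

end CapGraph

/-- A (single-commodity) demand: a vertex weight function of total weight zero. -/
def IsDemand {V : Type*} [Fintype V] (d : V → ℝ) : Prop :=
  ∑ v, d v = 0

/-- The flow `f` routes `d`: the net flow out of each vertex `u` is `d u`. -/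
def Routes {V : Type*} [Fintype V] (f : V → V → ℝ) (d : V → ℝ) : Prop :=
  ∀ u, ∑ v, f u v = d u

/-- `𝒞` is an `α`-congestion approximator for `G`: `α ≥ 1`, and every demand that does not exceed
the capacity of any cut of `𝒞` can be routed in `G` with congestion `α`. -/
def IsCongestionApproximator {V : Type*} [Fintype V] [DecidableEq V] (G : CapGraph V)
    (α : ℝ) (𝒞 : Set (Finset V)) : Prop :=
  1 ≤ α ∧ ∀ d : V → ℝ, IsDemand d → (∀ C ∈ 𝒞, |∑ v ∈ C, d v| ≤ (G.cutCap C : ℝ)) →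
    ∃ f : V → V → ℝ, G.IsFlow f ∧ Routes f d ∧ G.HasCongestion f α

/-- Any two members of the family are nested or disjoint. -/
def IsLaminar {V : Type*} (𝒞 : Set (Finset V)) : Prop :=
  ∀ A ∈ 𝒞, ∀ B ∈ 𝒞, A ⊆ B ∨ B ⊆ A ∨ Disjoint A B

/-- A hierarchical congestion approximator with approximation guarantee `α`. -/
def IsHierarchicalCongestionApproximator {V : Type*} [Fintype V] [DecidableEq V]
    (G : CapGraph V) (α : ℝ) (𝒞 : Set (Finset V)) : Prop :=
  IsLaminar 𝒞 ∧ IsCongestionApproximator G α 𝒞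

/-!
The graph is an `N × N` grid, `N = ⌊√(n - 1)⌋`, whose first column and bottom row are joined to an
extra vertex `z`; the remaining vertices hang at `z`. Replacing sets by complements, the members of
a laminar family may be assumed to avoid `z` (`IsLaminar.avoiding`,
`IsCongestionApproximator.avoiding`). Such a set with `m` grid vertices has cut capacity at least
`√m` (`sqrt_gridCount_le_cutCap`).

If the family `𝓕` is an `α`-congestion approximator, a demand satisfying its constraints pairs with
a potential `F` to at most `α` times the variation of `F`. By duality, a potential vanishing at `z`
is therefore a combination `∑ y C • 1_C` over `C ∈ 𝓕` with `∑ |y C| cap C` at most `α` times that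
variation (`IsCongestionApproximator.exists_decomposition`). The two coordinate functions of the
grid have variation `O(N²)`, and together they yield planar increments `y C ∈ ℝ²` that sum, along
the members containing a grid vertex, to the position of this vertex, with
`∑ |y C| √m(C) = O(α N²)`.

The laminar family is thus a tree drawn in the plane with edge vectors `y C`. Fix a scale `s ≤ N`
and let `L` be the length of the subtree formed by the sets with at least `s²` grid vertices. The
smaller sets have to carry each vertex from this subtree to its position. Vertices at distance `s`
from the subtree are expensive in that respect, and a tree of length `L` comes within distance `s`
of `O(s L)` vertices only. To see the latter, a bump function of radius `s` is placed at every
vertex: at a given point only `O(s²)` of them are nonzero, so that the total of their variations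
along the tree is `O(s² L)`, whereas a bump whose centre the tree approaches closely varies by about
`s`, since it vanishes at the root. Hence
`N² s ≤ ∑_{m(C) < s²} m(C) |y C| + O(s²) ∑_{m(C) ≥ s²} |y C|` (`grid_scale_le`). After division by
`s`, a set `C` contributes over all dyadic scales `s` a geometric sum dominated by `s ≈ √m(C)`, that
is `O(√m(C) |y C|)`, while each of the `log₂ N` scales requires `N²` (`log_mul_sq_le_sum_sqrt`).
Therefore `N² log N = O(α N²)`.
-/


/-! ### Sums over dyadic scales -/

theorem sum_dyadic_le_of_le (t : ℝ) (ht : 0 ≤ t) (k : ℕ) :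
    ∑ i ∈ Finset.range k, (if (2 : ℝ) ^ i ≤ t then (2 : ℝ) ^ i else 0) ≤ min (2 * t) (2 ^ k) := by
  induction k with
  | zero => simp [ht]
  | succ k ih =>
    rw [Finset.sum_range_succ, pow_succ]
    have h1 := ih.trans (min_le_left _ _)
    have h2 := ih.trans (min_le_right _ _)
    have h3 : (0 : ℝ) < 2 ^ k := by positivity
    split_ifs with h
    · exact le_min (by linarith) (by linarith)
    · exact le_min (by linarith) (by linarith)

theorem sum_dyadic_le_of_lt (t : ℝ) (ht : 0 ≤ t) (k : ℕ) :
    ∑ i ∈ Finset.range k, (if (2 : ℝ) ^ i ≤ t then 0 else t ^ 2 / (2 : ℝ) ^ i) ≤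
      max 0 (2 * t - 2 * (t ^ 2 / 2 ^ k)) := by
  induction k with
  | zero => simp
  | succ k ih =>
    rw [Finset.sum_range_succ]
    have h3 : (0 : ℝ) < 2 ^ k := by positivity
    have h4 : t ^ 2 / 2 ^ (k + 1) = t ^ 2 / 2 ^ k / 2 := by rw [pow_succ (2 : ℝ) k, div_div]
    split_ifs with h
    · have : t ≤ t ^ 2 / 2 ^ k := by
        rw [le_div_iff₀ h3]; nlinarith
      rw [max_eq_left (by linarith)] at ih
      exact le_trans (by linarith) (le_max_left _ _)
    · have : t ^ 2 / 2 ^ k ≤ t := by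
        rw [div_le_iff₀ h3]; nlinarith
      rw [max_eq_right (by linarith)] at ih
      exact le_trans (by linarith) (le_max_right _ _)

/-- Each weight profile concentrates geometrically around the scale `t`, so that the sum over all
dyadic scales is proportional to `t`. -/
theorem sum_dyadic_scales_le (t : ℝ) (ht : 0 ≤ t) (k : ℕ) :
    ∑ i ∈ Finset.range k,
      (if (2 : ℝ) ^ i ≤ t then 18 * (2 : ℝ) ^ i else t ^ 2 / (2 : ℝ) ^ i) ≤ 38 * t := by
  have h1 := (sum_dyadic_le_of_le t ht k).trans (min_le_left _ _)
  have h2 := sum_dyadic_le_of_lt t ht k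
  have h3 : max 0 (2 * t - 2 * (t ^ 2 / 2 ^ k)) ≤ 2 * t :=
    max_le (by linarith) (by have : 0 ≤ t ^ 2 / 2 ^ k := by positivity
                             linarith)
  have h4 : ∑ i ∈ Finset.range k,
      (if (2 : ℝ) ^ i ≤ t then 18 * (2 : ℝ) ^ i else t ^ 2 / (2 : ℝ) ^ i) =
      18 * ∑ i ∈ Finset.range k, (if (2 : ℝ) ^ i ≤ t then (2 : ℝ) ^ i else 0) +
      ∑ i ∈ Finset.range k, (if (2 : ℝ) ^ i ≤ t then 0 else t ^ 2 / (2 : ℝ) ^ i) := by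
    rw [Finset.mul_sum, ← Finset.sum_add_distrib]
    refine Finset.sum_congr rfl fun i _ => ?_
    split_ifs <;> simp
  rw [h4]; linarith

/-! ### Bump functions centred at lattice points -/

/-- The cone of height and `ℓ¹`-radius `s` centred at `c`. -/
noncomputable def bump (s : ℝ) (c q : ℝ × ℝ) : ℝ :=
  max 0 (s - (|q.1 - c.1| + |q.2 - c.2|))

theorem abs_bump_sub_le (s : ℝ) (c p q : ℝ × ℝ) :
    |bump s c p - bump s c q| ≤ |p.1 - q.1| + |p.2 - q.2| := by
  have h := abs_max_sub_max_le_abs (s - (|p.1 - c.1| + |p.2 - c.2|))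
    (s - (|q.1 - c.1| + |q.2 - c.2|)) 0
  rw [max_comm, max_comm _ (0 : ℝ)] at h
  refine h.trans ?_
  have h1 := abs_abs_sub_abs_le_abs_sub (q.1 - c.1) (p.1 - c.1)
  have h2 := abs_abs_sub_abs_le_abs_sub (q.2 - c.2) (p.2 - c.2)
  rw [show q.1 - c.1 - (p.1 - c.1) = -(p.1 - q.1) by ring, abs_neg] at h1
  rw [show q.2 - c.2 - (p.2 - c.2) = -(p.2 - q.2) by ring, abs_neg] at h2
  rw [show s - (|p.1 - c.1| + |p.2 - c.2|) - (s - (|q.1 - c.1| + |q.2 - c.2|)) =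
    (|q.1 - c.1| - |p.1 - c.1|) + (|q.2 - c.2| - |p.2 - c.2|) by ring]
  exact (abs_add_le _ _).trans (add_le_add h1 h2)

theorem bump_eq_zero {s : ℝ} {c q : ℝ × ℝ} (h : ¬ (|q.1 - c.1| < s ∧ |q.2 - c.2| < s)) :
    bump s c q = 0 := by
  apply max_eq_left
  by_contra! h'
  exact h ⟨by linarith [abs_nonneg (q.2 - c.2)], by linarith [abs_nonneg (q.1 - c.1)]⟩

theorem card_fin_near_le (N s : ℕ) (x : ℝ) :
    (Finset.univ.filter fun a : Fin N => |x - (a : ℝ)| < s).card ≤ 2 * s + 1 := by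
  have h : (Finset.univ.filter fun a : Fin N => |x - (a : ℝ)| < s).card ≤
      (Finset.Icc ⌈x - s⌉ ⌊x + s⌋).card := by
    refine Finset.card_le_card_of_injOn (fun a : Fin N => ((a : ℕ) : ℤ)) ?_ ?_
    · intro a ha
      have ha' := abs_lt.1 (Finset.mem_filter.1 ha).2
      rw [Finset.mem_coe, Finset.mem_Icc, Int.ceil_le, Int.le_floor]
      push_cast
      exact ⟨by linarith, by linarith⟩
    · intro a _ b _ hab
      exact Fin.ext (by simpa using hab)
  refine h.trans ?_
  rw [Int.card_Icc, Int.toNat_le]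
  have h1 := Int.floor_le (x + s)
  have h2 := Int.le_ceil (x - s)
  have : ((⌊x + s⌋ + 1 - ⌈x - s⌉ : ℤ) : ℝ) ≤ ((2 * s + 1 : ℕ) : ℤ) := by
    push_cast; linarith
  exact_mod_cast this

/-- The position in the plane of a vertex of the `N × N` grid. The first coordinate is shifted
by `N`, so that no bump of radius at most `N` centred at a grid vertex reaches the origin. -/
def gridPos {N : ℕ} (p : Fin N × Fin N) : ℝ × ℝ := (N + (p.1 : ℝ), (p.2 : ℝ))

theorem card_grid_near_le (N s : ℕ) (hs : 1 ≤ s) (q : ℝ × ℝ) :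
    (Finset.univ.filter fun p : Fin N × Fin N =>
      |q.1 - (gridPos p).1| < s ∧ |q.2 - (gridPos p).2| < s).card ≤ 9 * s ^ 2 := by
  have h : (Finset.univ.filter fun p : Fin N × Fin N =>
      |q.1 - (gridPos p).1| < s ∧ |q.2 - (gridPos p).2| < s) ⊆
      (Finset.univ.filter fun a : Fin N => |(q.1 - N) - (a : ℝ)| < s) ×ˢ
      (Finset.univ.filter fun a : Fin N => |q.2 - (a : ℝ)| < s) := by
    intro p hp
    have hp' := (Finset.mem_filter.1 hp).2
    rw [Finset.mem_product, Finset.mem_filter, Finset.mem_filter]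
    rw [gridPos, ← sub_sub] at hp'
    exact ⟨⟨Finset.mem_univ _, hp'.1⟩, Finset.mem_univ _, hp'.2⟩
  refine (Finset.card_le_card h).trans ?_
  rw [Finset.card_product]
  refine (Nat.mul_le_mul (card_fin_near_le N s _) (card_fin_near_le N s _)).trans ?_
  nlinarith

/-- Bumps of radius `s` centred at all grid vertices overlap at most `O(s²)` times, hence so much
is the total variation that they see along a segment. -/
theorem sum_abs_bump_sub_le (N s : ℕ) (hs : 1 ≤ s) (q r : ℝ × ℝ) :
    ∑ p : Fin N × Fin N, |bump s (gridPos p) q - bump s (gridPos p) r| ≤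
      18 * (s : ℝ) ^ 2 * (|q.1 - r.1| + |q.2 - r.2|) := by
  set ℓ := |q.1 - r.1| + |q.2 - r.2| with hℓ
  have hℓ0 : 0 ≤ ℓ := by positivity
  let near : ℝ × ℝ → Fin N × Fin N → Prop := fun q p =>
    |q.1 - (gridPos p).1| < s ∧ |q.2 - (gridPos p).2| < s
  classical
  have hcard : ∀ q, ∑ p : Fin N × Fin N, (if near q p then ℓ else 0) ≤ 9 * (s : ℝ) ^ 2 * ℓ := by
    intro q
    rw [← Finset.sum_filter, Finset.sum_const, nsmul_eq_mul]
    refine mul_le_mul_of_nonneg_right ?_ hℓ0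
    have := card_grid_near_le N s hs q
    exact_mod_cast this
  have hterm : ∀ p : Fin N × Fin N, |bump s (gridPos p) q - bump s (gridPos p) r| ≤
      (if near q p then ℓ else 0) + (if near r p then ℓ else 0) := by
    intro p
    have h := abs_bump_sub_le s (gridPos p) q r
    by_cases h1 : near q p
    · rw [if_pos h1]
      split_ifs <;> linarith
    · by_cases h2 : near r p
      · rw [if_neg h1, if_pos h2]; linarith
      · rw [bump_eq_zero h1, bump_eq_zero h2, if_neg h1, if_neg h2]; simp
  refine (Finset.sum_le_sum fun p _ => hterm p).trans ?_
  rw [Finset.sum_add_distrib]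
  linarith [hcard q, hcard r]

/-! ### Laminar families of subsets of the grid -/

/-- Along a chain of sets carrying increments `y`, the total change of a function `h` is at most
the sum of its changes at the single steps. -/
theorem sub_le_sum_abs_chain {V A : Type*} [DecidableEq V] [AddCommMonoid A]
    (h : A → ℝ) (y : Finset V → A) (𝒦 : Finset (Finset V))
    (hch : ∀ C ∈ 𝒦, ∀ D ∈ 𝒦, C ⊆ D ∨ D ⊆ C) :
    h (∑ C ∈ 𝒦, y C) - h 0 ≤ ∑ C ∈ 𝒦, |h (∑ D ∈ 𝒦 with C ⊆ D, y D) -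
      h (∑ D ∈ 𝒦 with C ⊂ D, y D)| := by
  induction hn : 𝒦.card generalizing 𝒦 with
  | zero => simp [Finset.card_eq_zero.1 hn]
  | succ n ih =>
    have hne : 𝒦.Nonempty := Finset.card_pos.1 (by omega)
    obtain ⟨C, hC, hmin⟩ := 𝒦.exists_min_image Finset.card hne
    have hsub : ∀ D ∈ 𝒦, C ⊆ D := by
      intro D hD
      rcases hch C hC D hD with h' | h'
      · exact h'
      · exact (Finset.eq_of_subset_of_card_le h' (hmin D hD)).symm.subset
    have hall : (𝒦.filter fun D => C ⊆ D) = 𝒦 := Finset.filter_true_of_mem hsub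
    have hstrict : (𝒦.filter fun D => C ⊂ D) = 𝒦.erase C := by
      ext D
      simp only [Finset.mem_filter, Finset.mem_erase]
      constructor
      · rintro ⟨hD, hCD⟩
        exact ⟨hCD.ne', hD⟩
      · rintro ⟨hne', hD⟩
        exact ⟨hD, (hsub D hD).ssubset_of_ne hne'.symm⟩
    have ih' := ih (𝒦.erase C) (fun A hA B hB => hch A (Finset.mem_of_mem_erase hA) B
      (Finset.mem_of_mem_erase hB)) (by rw [Finset.card_erase_of_mem hC]; omega)
    have htot := Finset.add_sum_erase 𝒦 (fun D => |h (∑ E ∈ 𝒦 with D ⊆ E, y E) -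
      h (∑ E ∈ 𝒦 with D ⊂ E, y E)|) hC
    rw [hall, hstrict] at htot
    have hrest : ∑ D ∈ 𝒦.erase C, |h (∑ E ∈ 𝒦.erase C with D ⊆ E, y E) -
        h (∑ E ∈ 𝒦.erase C with D ⊂ E, y E)| =
        ∑ D ∈ 𝒦.erase C, |h (∑ E ∈ 𝒦 with D ⊆ E, y E) - h (∑ E ∈ 𝒦 with D ⊂ E, y E)| := by
      refine Finset.sum_congr rfl fun D hD => ?_
      have hDC := Finset.mem_erase.1 hD
      have h1 : ¬ D ⊆ C := fun h' => hDC.1 (h'.antisymm (hsub D hDC.2))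
      have h2 : ¬ D ⊂ C := fun h' => h1 h'.subset
      rw [Finset.filter_erase, Finset.filter_erase, Finset.erase_eq_of_notMem (by simp [h1]),
        Finset.erase_eq_of_notMem (by simp [h2])]
    rw [hrest] at ih'
    linarith [le_abs_self (h (∑ D ∈ 𝒦, y D) - h (∑ D ∈ 𝒦.erase C, y D))]

/-- The number of grid vertices in the set `C`, the grid being embedded by `ι`. -/
def gridCount {V : Type*} [DecidableEq V] {N : ℕ} (ι : Fin N × Fin N → V) (C : Finset V) : ℕ :=
  (Finset.univ.filter fun p => ι p ∈ C).card

theorem sum_sum_mem_eq {V : Type*} [DecidableEq V] {N : ℕ} (ι : Fin N × Fin N → V)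
    (𝓖 : Finset (Finset V)) (w : Finset V → ℝ) :
    ∑ p, ∑ C ∈ 𝓖 with ι p ∈ C, w C = ∑ C ∈ 𝓖, (gridCount ι C : ℝ) * w C := by
  simp_rw [Finset.sum_filter]
  rw [Finset.sum_comm]
  refine Finset.sum_congr rfl fun C _ => ?_
  rw [← Finset.sum_filter, Finset.sum_const, nsmul_eq_mul, gridCount]

/-- If the position of each grid vertex is the sum of the increments `y C` of the members of a
laminar family containing it, then at scale `s` either the sets with fewer than `s²` grid vertices
displace the vertices by about `s` on average, or the tree formed by the larger sets is so long that
it passes near most vertices. -/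
theorem grid_scale_le {V : Type*} [DecidableEq V] {N s : ℕ} (hs : 1 ≤ s) (hsN : s ≤ N)
    (ι : Fin N × Fin N → V) (𝓕 : Finset (Finset V)) (hlam : IsLaminar (𝓕 : Set (Finset V)))
    (y : Finset V → ℝ × ℝ) (hy : ∀ p, gridPos p = ∑ C ∈ 𝓕 with ι p ∈ C, y C) :
    (N : ℝ) ^ 2 * s ≤ ∑ C ∈ 𝓕, (if s ^ 2 ≤ gridCount ι C then 18 * (s : ℝ) ^ 2
      else (gridCount ι C : ℝ)) * (|(y C).1| + |(y C).2|) := by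
  set w : Finset V → ℝ := fun C => |(y C).1| + |(y C).2| with hw
  set H := 𝓕.filter fun C => s ^ 2 ≤ gridCount ι C with hH
  set S := 𝓕.filter fun C => ¬ s ^ 2 ≤ gridCount ι C with hS
  -- the ends of the tree segment that the large set `C` contributes
  let hi : Finset V → ℝ × ℝ := fun C => ∑ D ∈ H with C ⊆ D, y D
  let lo : Finset V → ℝ × ℝ := fun C => ∑ D ∈ H with C ⊂ D, y D
  have hhilo : ∀ C ∈ H, hi C - lo C = y C := by
    intro C hC
    have : (H.filter fun D => C ⊆ D) = insert C (H.filter fun D => C ⊂ D) := by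
      ext D
      simp only [Finset.mem_filter, Finset.mem_insert]
      constructor
      · rintro ⟨hD, hCD⟩
        rcases hCD.eq_or_ssubset with h | h
        · exact Or.inl h.symm
        · exact Or.inr ⟨hD, h⟩
      · rintro (rfl | ⟨hD, hCD⟩)
        · exact ⟨hC, subset_rfl⟩
        · exact ⟨hD, hCD.subset⟩
    simp only [hi, lo]
    rw [this, Finset.sum_insert (by simp)]
    abel
  have hvert : ∀ p : Fin N × Fin N, (s : ℝ) ≤ ∑ C ∈ S with ι p ∈ C, w C +
      ∑ C ∈ H, |bump s (gridPos p) (hi C) - bump s (gridPos p) (lo C)| := by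
    intro p
    set Φ : ℝ × ℝ := ∑ C ∈ H with ι p ∈ C, y C with hΦ
    have hsplit : gridPos p - Φ = ∑ C ∈ S with ι p ∈ C, y C := by
      have h := Finset.sum_filter_add_sum_filter_not (𝓕.filter fun C => ι p ∈ C)
        (fun C => s ^ 2 ≤ gridCount ι C) y
      rw [Finset.filter_comm (fun C => ι p ∈ C), ← hH, Finset.filter_comm (fun C => ι p ∈ C), ← hS,
        ← hy p, ← hΦ] at h
      rw [← h, add_sub_cancel_left]
    have hdist : |(gridPos p).1 - Φ.1| + |(gridPos p).2 - Φ.2| ≤ ∑ C ∈ S with ι p ∈ C, w C := by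
      have h1 := congrArg Prod.fst hsplit
      have h2 := congrArg Prod.snd hsplit
      rw [Prod.fst_sub] at h1
      rw [Prod.snd_sub] at h2
      rw [h1, h2, Prod.fst_sum, Prod.snd_sum, hw, Finset.sum_add_distrib]
      exact add_le_add (Finset.abs_sum_le_sum_abs _ _) (Finset.abs_sum_le_sum_abs _ _)
    have htop : bump s (gridPos p) (gridPos p) = s := by simp [bump]
    have hbot : bump s (gridPos p) 0 = 0 := by
      apply max_eq_left
      have h1 : (s : ℝ) ≤ N := by exact_mod_cast hsN
      have h2 : (0 : ℝ) ≤ N + (p.1 : ℝ) := by positivity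
      have h3 : (0 : ℝ) ≤ (p.1 : ℝ) := by positivity
      simp only [gridPos, Prod.fst_zero, Prod.snd_zero, zero_sub, abs_neg]
      rw [abs_of_nonneg h2]
      linarith [abs_nonneg ((p.2 : ℕ) : ℝ)]
    have hlip := (le_abs_self _).trans (abs_bump_sub_le s (gridPos p) (gridPos p) Φ)
    have hchain := sub_le_sum_abs_chain (bump s (gridPos p)) y (H.filter fun C => ι p ∈ C) (by
      intro C hC D hD
      simp only [hH, Finset.mem_filter] at hC hD
      rcases hlam C hC.1.1 D hD.1.1 with h | h | h
      · exact Or.inl h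
      · exact Or.inr h
      · exact absurd hD.2 (Finset.disjoint_left.1 h hC.2))
    rw [← hΦ] at hchain
    have hpath : ∑ C ∈ H with ι p ∈ C,
        |bump s (gridPos p) (∑ D ∈ H.filter (fun C => ι p ∈ C) with C ⊆ D, y D) -
          bump s (gridPos p) (∑ D ∈ H.filter (fun C => ι p ∈ C) with C ⊂ D, y D)| =
        ∑ C ∈ H with ι p ∈ C, |bump s (gridPos p) (hi C) - bump s (gridPos p) (lo C)| := by
      refine Finset.sum_congr rfl fun C hC => ?_
      have hp := (Finset.mem_filter.1 hC).2
      simp only [hi, lo, Finset.filter_filter]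
      have h1 : (H.filter fun D => ι p ∈ D ∧ C ⊆ D) = H.filter fun D => C ⊆ D :=
        Finset.filter_congr fun D _ => and_iff_right_of_imp fun h => h hp
      have h2 : (H.filter fun D => ι p ∈ D ∧ C ⊂ D) = H.filter fun D => C ⊂ D :=
        Finset.filter_congr fun D _ => and_iff_right_of_imp fun h => h.subset hp
      rw [h1, h2]
    have hmono : ∑ C ∈ H with ι p ∈ C,
        |bump s (gridPos p) (hi C) - bump s (gridPos p) (lo C)| ≤
        ∑ C ∈ H, |bump s (gridPos p) (hi C) - bump s (gridPos p) (lo C)| :=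
      Finset.sum_le_sum_of_subset_of_nonneg (Finset.filter_subset _ _)
        fun _ _ _ => abs_nonneg _
    rw [hpath] at hchain
    linarith
  have hsum := Finset.sum_le_sum fun p (_ : p ∈ Finset.univ) => hvert p
  rw [Finset.sum_const, Finset.card_univ, Fintype.card_prod, Fintype.card_fin,
    Finset.sum_add_distrib, sum_sum_mem_eq, Finset.sum_comm, nsmul_eq_mul] at hsum
  have hbig : ∑ C ∈ H, ∑ p : Fin N × Fin N,
      |bump s (gridPos p) (hi C) - bump s (gridPos p) (lo C)| ≤
      ∑ C ∈ H, 18 * (s : ℝ) ^ 2 * w C := by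
    refine Finset.sum_le_sum fun C hC => (sum_abs_bump_sub_le N s hs _ _).trans (le_of_eq ?_)
    rw [← Prod.fst_sub, ← Prod.snd_sub, hhilo C hC]
  have hfin : ∑ C ∈ 𝓕, (if s ^ 2 ≤ gridCount ι C then 18 * (s : ℝ) ^ 2
      else (gridCount ι C : ℝ)) * w C =
      ∑ C ∈ H, 18 * (s : ℝ) ^ 2 * w C + ∑ C ∈ S, (gridCount ι C : ℝ) * w C := by
    simp_rw [ite_mul]
    rw [Finset.sum_ite]
  rw [hfin]
  push_cast at hsum
  linarith [sq (N : ℝ)]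

/-- Summing over the dyadic scales up to `N`: a set with `m` grid vertices matters only at the
scales near `√m`, whereas each scale needs a total of `N²`. -/
theorem log_mul_sq_le_sum_sqrt {V : Type*} [DecidableEq V] {N : ℕ} (hN : N ≠ 0)
    (ι : Fin N × Fin N → V) (𝓕 : Finset (Finset V)) (hlam : IsLaminar (𝓕 : Set (Finset V)))
    (y : Finset V → ℝ × ℝ) (hy : ∀ p, gridPos p = ∑ C ∈ 𝓕 with ι p ∈ C, y C) :
    ((Nat.log 2 N + 1 : ℕ) : ℝ) * (N : ℝ) ^ 2 ≤
      38 * ∑ C ∈ 𝓕, √(gridCount ι C) * (|(y C).1| + |(y C).2|) := by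
  have hscale : ∀ i ∈ Finset.range (Nat.log 2 N + 1), (N : ℝ) ^ 2 ≤
      ∑ C ∈ 𝓕, (if (2 : ℝ) ^ i ≤ √(gridCount ι C) then 18 * (2 : ℝ) ^ i
        else √(gridCount ι C) ^ 2 / (2 : ℝ) ^ i) * (|(y C).1| + |(y C).2|) := by
    intro i hi
    have hiN : 2 ^ i ≤ N := Nat.pow_le_of_le_log hN (by simpa [Nat.lt_succ_iff] using hi)
    have h := grid_scale_le (Nat.one_le_two_pow (n := i)) hiN ι 𝓕 hlam y hy
    have h2 : (0 : ℝ) < 2 ^ i := by positivity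
    rw [← mul_le_mul_iff_left₀ h2, Finset.sum_mul]
    push_cast at h
    refine h.trans (le_of_eq (Finset.sum_congr rfl fun C _ => ?_))
    have hiff : (2 ^ i) ^ 2 ≤ gridCount ι C ↔ (2 : ℝ) ^ i ≤ √(gridCount ι C) := by
      rw [Real.le_sqrt' h2]
      exact_mod_cast Iff.rfl
    have hsq : √(gridCount ι C : ℝ) ^ 2 = gridCount ι C := Real.sq_sqrt (Nat.cast_nonneg _)
    simp only [hiff, hsq]
    split_ifs
    · ring
    · field_simp
  have hsum := Finset.sum_le_sum hscale
  rw [Finset.sum_const, Finset.card_range, nsmul_eq_mul, Finset.sum_comm] at hsum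
  refine hsum.trans ?_
  rw [Finset.mul_sum]
  refine Finset.sum_le_sum fun C _ => ?_
  rw [← Finset.sum_mul, ← mul_assoc]
  exact mul_le_mul_of_nonneg_right (sum_dyadic_scales_le _ (Real.sqrt_nonneg _) _) (by positivity)

/-! ### Laminar families avoiding a vertex -/

theorem CapGraph.cutCap_compl {V : Type*} [Fintype V] [DecidableEq V] (G : CapGraph V)
    (C : Finset V) : G.cutCap Cᶜ = G.cutCap C := by
  rw [CapGraph.cutCap, CapGraph.cutCap, compl_compl, Finset.sum_comm]
  exact Finset.sum_congr rfl fun u _ => Finset.sum_congr rfl fun v _ => G.cap_symm v u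

/-- The family obtained from `𝒞` by replacing each member containing `z` by its complement,
without the empty set. -/
def avoiding {V : Type*} [Fintype V] [DecidableEq V] (z : V) (𝒞 : Set (Finset V)) :
    Set (Finset V) :=
  {C | z ∉ C ∧ C.Nonempty ∧ (C ∈ 𝒞 ∨ Cᶜ ∈ 𝒞)}

theorem IsLaminar.avoiding {V : Type*} [Fintype V] [DecidableEq V] {𝒞 : Set (Finset V)}
    (h : IsLaminar 𝒞) (z : V) : IsLaminar (avoiding z 𝒞) := by
  rintro A ⟨hzA, -, hA⟩ B ⟨hzB, -, hB⟩
  rcases hA with hA | hA <;> rcases hB with hB | hB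
  · exact h A hA B hB
  · rcases h A hA _ hB with h' | h' | h'
    · exact Or.inr (Or.inr (by simpa using Finset.subset_compl_iff_disjoint_right.1 h'))
    · exact absurd (h' (Finset.mem_compl.2 hzB)) hzA
    · exact Or.inl (by simpa using Finset.subset_compl_iff_disjoint_right.2 h')
  · rcases h _ hA B hB with h' | h' | h'
    · exact absurd (h' (Finset.mem_compl.2 hzA)) hzB
    · exact Or.inr (Or.inr (Finset.subset_compl_iff_disjoint_right.1 h').symm)
    · exact Or.inr (Or.inl (by simpa using Finset.subset_compl_iff_disjoint_right.2 h'.symm))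
  · rcases h _ hA _ hB with h' | h' | h'
    · exact Or.inr (Or.inl (Finset.compl_subset_compl.1 h'))
    · exact Or.inl (Finset.compl_subset_compl.1 h')
    · exact absurd (Finset.mem_compl.2 hzB)
        (Finset.disjoint_left.1 h' (Finset.mem_compl.2 hzA))

/-- A cut and its complement impose the same constraint on a demand. -/
theorem IsCongestionApproximator.avoiding {V : Type*} [Fintype V] [DecidableEq V]
    {G : CapGraph V} {α : ℝ} {𝒞 : Set (Finset V)} (h : IsCongestionApproximator G α 𝒞) (z : V) :
    IsCongestionApproximator G α (avoiding z 𝒞) := by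
  refine ⟨h.1, fun d hd hC => h.2 d hd fun C hmem => ?_⟩
  have hcompl : |∑ v ∈ Cᶜ, d v| = |∑ v ∈ C, d v| := by
    have : ∑ v ∈ Cᶜ, d v = -∑ v ∈ C, d v := by
      rw [eq_neg_iff_add_eq_zero, add_comm, Finset.sum_add_sum_compl]
      exact hd
    rw [this, abs_neg]
  by_cases hz : z ∈ C
  · rw [← hcompl, ← G.cutCap_compl C]
    rcases Cᶜ.eq_empty_or_nonempty with he | hne
    · simp [he]
    · exact hC _ ⟨by simpa using hz, hne, Or.inr (by simpa using hmem)⟩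
  · rcases C.eq_empty_or_nonempty with he | hne
    · simp [he]
    · exact hC _ ⟨hz, hne, Or.inl hmem⟩

/-! ### Flows against potentials, and linear programming duality -/

/-- The total variation of a potential over the edges, each edge being counted in both
directions. -/
def CapGraph.variation {V : Type*} [Fintype V] (G : CapGraph V) (F : V → ℝ) : ℝ :=
  ∑ u, ∑ v, (G.cap u v : ℝ) * |F u - F v|

theorem two_mul_sum_potential_le {V : Type*} [Fintype V] {G : CapGraph V} {α : ℝ}
    {f : V → V → ℝ} {d : V → ℝ} (hf : G.IsFlow f) (hd : Routes f d) (hc : G.HasCongestion f α)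
    (F : V → ℝ) : 2 * ∑ v, F v * d v ≤ α * G.variation F := by
  have h1 : ∑ v, F v * d v = ∑ u, ∑ v, F u * f u v :=
    Finset.sum_congr rfl fun u _ => by rw [← hd u, Finset.mul_sum]
  have h2 : ∑ v, F v * d v = ∑ u, ∑ v, -(F v * f u v) := by
    rw [h1, Finset.sum_comm]
    refine Finset.sum_congr rfl fun u _ => Finset.sum_congr rfl fun v _ => ?_
    rw [hf.antisymm v u, mul_neg]
  have h3 : 2 * ∑ v, F v * d v = ∑ u, ∑ v, (F u - F v) * f u v := by
    rw [two_mul]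
    nth_rewrite 1 [h1]
    rw [h2, ← Finset.sum_add_distrib]
    refine Finset.sum_congr rfl fun u _ => ?_
    rw [← Finset.sum_add_distrib]
    exact Finset.sum_congr rfl fun v _ => by ring
  rw [h3, CapGraph.variation, Finset.mul_sum]
  refine Finset.sum_le_sum fun u _ => ?_
  rw [Finset.mul_sum]
  refine Finset.sum_le_sum fun v _ => ?_
  calc (F u - F v) * f u v ≤ |F u - F v| * |f u v| := by
        rw [← abs_mul]; exact le_abs_self _
    _ ≤ |F u - F v| * (α * G.cap u v) := mul_le_mul_of_nonneg_left (hc u v) (abs_nonneg _)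
    _ = α * (G.cap u v * |F u - F v|) := by ring

/-- Duality: if no `d` with `|d(C)| ≤ κ C` for all `C ∈ 𝓕` pairs with `F` to more than `M`, then
`F` is a combination of the indicators of the members of `𝓕` of `κ`-weighted cost at most `M`. -/
theorem exists_indicator_decomposition {V : Type*} [Fintype V] [DecidableEq V]
    (𝓕 : Finset (Finset V)) (κ : Finset V → ℝ) (hκ : ∀ C ∈ 𝓕, 0 < κ C) (F : V → ℝ) {M : ℝ}
    (hM : 0 < M)
    (h : ∀ d : V → ℝ, (∀ C ∈ 𝓕, |∑ v ∈ C, d v| ≤ κ C) → ∑ v, F v * d v ≤ M) :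
    ∃ y : Finset V → ℝ, (∀ v, F v = ∑ C ∈ 𝓕 with v ∈ C, y C) ∧ ∑ C ∈ 𝓕, |y C| * κ C ≤ M := by
  let χ : Finset V → V → ℝ := fun C v => if v ∈ C then 1 else 0
  -- `K` consists of the combinations in question
  let P : Set (V → ℝ) := insert 0 ((fun C => (M / κ C) • χ C) '' 𝓕 ∪
    (fun C => -((M / κ C) • χ C)) '' 𝓕)
  let K : Set (V → ℝ) := {g | ∃ y : Finset V → ℝ, (∀ v, g v = ∑ C ∈ 𝓕 with v ∈ C, y C) ∧
    ∑ C ∈ 𝓕, |y C| * κ C ≤ M}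
  have hPfin : P.Finite :=
    (((𝓕.finite_toSet.image _).union (𝓕.finite_toSet.image _)).insert _)
  have hK : Convex ℝ K := by
    rintro g₁ ⟨y₁, h₁, c₁⟩ g₂ ⟨y₂, h₂, c₂⟩ a b ha hb hab
    refine ⟨fun C => a * y₁ C + b * y₂ C, fun v => ?_, ?_⟩
    · rw [Finset.sum_add_distrib, ← Finset.mul_sum, ← Finset.mul_sum, ← h₁, ← h₂]
      simp
    · calc ∑ C ∈ 𝓕, |a * y₁ C + b * y₂ C| * κ C
          ≤ ∑ C ∈ 𝓕, (a * (|y₁ C| * κ C) + b * (|y₂ C| * κ C)) := by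
            refine Finset.sum_le_sum fun C hC => ?_
            have h3 := abs_add_le (a * y₁ C) (b * y₂ C)
            rw [abs_mul, abs_mul, abs_of_nonneg ha, abs_of_nonneg hb] at h3
            calc _ ≤ (a * |y₁ C| + b * |y₂ C|) * κ C :=
                  mul_le_mul_of_nonneg_right h3 (hκ C hC).le
              _ = _ := by ring
        _ ≤ a * M + b * M := by
            rw [Finset.sum_add_distrib, ← Finset.mul_sum, ← Finset.mul_sum]
            exact add_le_add (mul_le_mul_of_nonneg_left c₁ ha) (mul_le_mul_of_nonneg_left c₂ hb)
        _ = M := by rw [← add_mul, hab, one_mul]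
  have hsingle : ∀ C ∈ 𝓕, ∀ c : ℝ, |c| * κ C ≤ M → c • χ C ∈ K := by
    intro C hC c hc
    refine ⟨fun D => if D = C then c else 0, fun v => ?_, ?_⟩
    · rw [Finset.sum_ite_eq']
      simp [χ, hC]
    · rw [Finset.sum_eq_single_of_mem C hC fun D _ hD => by simp [hD]]
      simpa using hc
  have hPK : P ⊆ K := by
    have hcost : ∀ C ∈ 𝓕, |M / κ C| * κ C ≤ M := by
      intro C hC
      rw [abs_of_pos (div_pos hM (hκ C hC)), div_mul_cancel₀ _ (hκ C hC).ne']
    rintro g (rfl | ⟨C, hC, rfl⟩ | ⟨C, hC, rfl⟩)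
    · exact ⟨0, by simp, by simpa using hM.le⟩
    · exact hsingle C hC _ (hcost C hC)
    · have := hsingle C hC (-(M / κ C)) (by rw [abs_neg]; exact hcost C hC)
      rwa [neg_smul] at this
  by_contra hF
  have hF' : F ∉ convexHull ℝ P := fun h' => hF (convexHull_min hPK hK h')
  obtain ⟨f, u, hfu, huF⟩ := geometric_hahn_banach_closed_point (convex_convexHull ℝ P)
    (hPfin.isClosed_convexHull ℝ) hF'
  have hfP : ∀ g ∈ P, f g < u := fun g hg => hfu g (subset_convexHull ℝ P hg)
  have hu : 0 < u := by simpa using hfP 0 (Set.mem_insert _ _)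
  let e : V → ℝ := fun v => f (Pi.single v 1)
  have hrep : ∀ g : V → ℝ, f g = ∑ v, g v * e v := by
    intro g
    have hg : g = ∑ v, g v • (Pi.single v (1 : ℝ) : V → ℝ) := by
      ext w
      simp [Finset.sum_apply, Pi.single_apply]
    conv_lhs => rw [hg]
    simp [e, map_sum]
  have hχ : ∀ C, f (χ C) = ∑ v ∈ C, e v := by
    intro C
    rw [hrep]
    simp [χ]
  have hle := h (fun v => M / u * e v) (by
    intro C hC
    rw [← Finset.mul_sum, ← hχ, abs_mul, abs_of_pos (div_pos hM hu)]
    have h1 := hfP _ (Set.mem_insert_of_mem _ (Or.inl ⟨C, hC, rfl⟩))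
    have h2 := hfP _ (Set.mem_insert_of_mem _ (Or.inr ⟨C, hC, rfl⟩))
    simp only [map_neg, map_smul, smul_eq_mul] at h1 h2
    have h3 : M / κ C * |f (χ C)| ≤ u := by
      rcases abs_cases (f (χ C)) with ⟨h', -⟩ | ⟨h', -⟩ <;> rw [h'] <;> linarith
    have hκC := hκ C hC
    rw [div_mul_eq_mul_div, div_le_iff₀ hκC] at h3
    rw [div_mul_eq_mul_div, div_le_iff₀ hu]
    linarith)
  have hval : ∑ v, F v * (M / u * e v) = M / u * f F := by
    rw [hrep, Finset.mul_sum]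
    exact Finset.sum_congr rfl fun v _ => by ring
  rw [hval, div_mul_eq_mul_div, div_le_iff₀ hu] at hle
  exact absurd (le_of_mul_le_mul_left hle hM) (not_le.2 huF)

/-- A potential vanishing at `z` decomposes along any congestion approximator whose members
avoid `z`, at a cost controlled by its variation. -/
theorem IsCongestionApproximator.exists_decomposition {V : Type*} [Fintype V] [DecidableEq V]
    {G : CapGraph V} {α : ℝ} {𝓕 : Finset (Finset V)}
    (h : IsCongestionApproximator G α (𝓕 : Set (Finset V))) {z : V} (hz : ∀ C ∈ 𝓕, z ∉ C)
    (hcap : ∀ C ∈ 𝓕, 0 < G.cutCap C) (F : V → ℝ) (hF : F z = 0) {M : ℝ} (hM : 0 < M)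
    (hvar : G.variation F ≤ 2 * M) :
    ∃ y : Finset V → ℝ, (∀ v, F v = ∑ C ∈ 𝓕 with v ∈ C, y C) ∧
      ∑ C ∈ 𝓕, |y C| * G.cutCap C ≤ α * M := by
  have hα : 0 < α := lt_of_lt_of_le one_pos h.1
  refine exists_indicator_decomposition 𝓕 (fun C => G.cutCap C)
    (fun C hC => by exact_mod_cast hcap C hC) F (mul_pos hα hM) fun d hd => ?_
  -- changing `d` at `z` only, it becomes a demand
  set d' : V → ℝ := d - Pi.single z (∑ v, d v) with hd'
  have hne : ∀ v, v ≠ z → d' v = d v := fun v hv => by simp [hd', hv]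
  have hdem : IsDemand d' := by simp [IsDemand, hd', Finset.sum_sub_distrib]
  obtain ⟨f, hf, hr, hc⟩ := h.2 d' hdem fun C hC => by
    rw [Finset.sum_congr rfl fun v hv => hne v fun h' => hz C hC (h' ▸ hv)]
    exact hd C hC
  have hpair : ∑ v, F v * d v = ∑ v, F v * d' v := by
    refine Finset.sum_congr rfl fun v _ => ?_
    by_cases hv : v = z
    · rw [hv, hF, zero_mul, zero_mul]
    · rw [hne v hv]
  have := two_mul_sum_potential_le hf hr hc F
  have := mul_le_mul_of_nonneg_left hvar hα.le
  rw [hpair]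
  linarith

/-! ### The wired grid -/

/-- The multigraph with edges `e : E` joining `s e` to `t e`; edges with `s e = t e` are
discarded. -/
def CapGraph.ofEdges {V E : Type*} [Fintype E] [DecidableEq V] (s t : E → V) : CapGraph V where
  cap u v := if u = v then 0 else
    ∑ e, ((if s e = u ∧ t e = v then 1 else 0) + if s e = v ∧ t e = u then 1 else 0)
  cap_symm u v := by
    by_cases h : u = v
    · rw [if_pos h, if_pos h.symm]
    · rw [if_neg h, if_neg (Ne.symm h)]
      exact Finset.sum_congr rfl fun e _ => add_comm _ _
  cap_self v := if_pos rfl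

theorem CapGraph.ofEdges_adj {V E : Type*} [Fintype E] [DecidableEq V] (s t : E → V) (e : E)
    (h : s e ≠ t e) : (CapGraph.ofEdges s t).toSimple.Adj (s e) (t e) := by
  change 0 < ite _ _ _
  rw [if_neg h]
  exact Finset.sum_pos' (fun _ _ => Nat.zero_le _) ⟨e, Finset.mem_univ _, by simp⟩

theorem CapGraph.card_le_cutCap_ofEdges {V E : Type*} [Fintype V] [Fintype E] [DecidableEq V]
    (s t : E → V) (C : Finset V) :
    (Finset.univ.filter fun e => s e ∈ C ∧ t e ∉ C).card ≤
      (CapGraph.ofEdges s t).cutCap C := by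
  have h : ∀ u ∈ C, ∀ v ∈ Cᶜ, (∑ e, if s e = u ∧ t e = v then 1 else 0) ≤
      (CapGraph.ofEdges s t).cap u v := by
    intro u hu v hv
    have huv : u ≠ v := fun h => Finset.mem_compl.1 hv (h ▸ hu)
    change _ ≤ ite _ _ _
    rw [if_neg huv]
    exact Finset.sum_le_sum fun e _ => Nat.le_add_right _ _
  refine le_trans (le_of_eq ?_)
    (Finset.sum_le_sum fun u hu => Finset.sum_le_sum fun v hv => h u hu v hv)
  rw [Finset.card_filter]
  simp_rw [Finset.sum_comm (s := Cᶜ)]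
  rw [Finset.sum_comm]
  refine Finset.sum_congr rfl fun e _ => ?_
  simp_rw [ite_and]
  by_cases h1 : s e ∈ C <;> by_cases h2 : t e ∈ C <;> simp [h1, h2]

theorem CapGraph.variation_ofEdges_le {V E : Type*} [Fintype V] [Fintype E] [DecidableEq V]
    (s t : E → V) (F : V → ℝ) :
    (CapGraph.ofEdges s t).variation F ≤ 2 * ∑ e, |F (s e) - F (t e)| := by
  have h : ∀ u v, ((CapGraph.ofEdges s t).cap u v : ℝ) * |F u - F v| ≤
      ∑ e, ((if s e = u ∧ t e = v then |F (s e) - F (t e)| else 0) +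
        if s e = v ∧ t e = u then |F (s e) - F (t e)| else 0) := by
    intro u v
    change ((ite _ _ _ : ℕ) : ℝ) * _ ≤ _
    split_ifs with huv
    · rw [Nat.cast_zero, zero_mul]
      positivity
    · push_cast
      rw [Finset.sum_mul]
      refine Finset.sum_le_sum fun e _ => le_of_eq ?_
      rw [add_mul]
      congr 1
      · split_ifs with h'
        · rw [h'.1, h'.2, one_mul]
        · rw [zero_mul]
      · split_ifs with h'
        · rw [h'.1, h'.2, one_mul, abs_sub_comm]
        · rw [zero_mul]
  refine (Finset.sum_le_sum fun u _ => Finset.sum_le_sum fun v _ => h u v).trans (le_of_eq ?_)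
  simp_rw [Finset.sum_comm (t := (Finset.univ : Finset E))]
  rw [Finset.mul_sum]
  refine Finset.sum_congr rfl fun e _ => ?_
  simp_rw [Finset.sum_add_distrib, ite_and]
  simp
  ring

/-- The left neighbour of a grid vertex, which is `z` for the vertices of the first column. -/
def leftNbr {V : Type*} {N : ℕ} (ι : Fin N × Fin N → V) (z : V) (p : Fin N × Fin N) : V :=
  if (p.1 : ℕ) = 0 then z else ι (⟨p.1 - 1, by omega⟩, p.2)

/-- The lower neighbour of a grid vertex, which is `z` for the vertices of the bottom row. -/
def lowerNbr {V : Type*} {N : ℕ} (ι : Fin N × Fin N → V) (z : V) (p : Fin N × Fin N) : V :=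
  if (p.2 : ℕ) = 0 then z else ι (p.1, ⟨p.2 - 1, by omega⟩)

/-- The other end of the pendant edge at a vertex outside the grid, which is `z`. The grid vertices
are their own ends, so that they carry no such edge. -/
noncomputable def pendantNbr {V : Type*} {N : ℕ} (ι : Fin N × Fin N → V) (z : V) (v : V) : V :=
  open Classical in if v ∈ Set.range ι then v else z

/-- Every nonempty row contributes an edge to the cut, at its leftmost vertex in `C`. -/
theorem card_rows_le {V : Type*} [DecidableEq V] {N : ℕ} {ι : Fin N × Fin N → V}
    {z : V} {C : Finset V} (hzC : z ∉ C) :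
    ((Finset.univ.filter fun p => ι p ∈ C).image Prod.snd).card ≤
      (Finset.univ.filter fun p => ι p ∈ C ∧ leftNbr ι z p ∉ C).card := by
  refine le_trans (Finset.card_le_card ?_) (Finset.card_image_le (f := Prod.snd))
  intro b hb
  obtain ⟨p, hp, rfl⟩ := Finset.mem_image.1 hb
  have hne : (Finset.univ.filter fun a : Fin N => ι (a, p.2) ∈ C).Nonempty :=
    ⟨p.1, by simpa using hp⟩
  obtain ⟨a, ha, hmin⟩ := Finset.exists_min_image _ (fun a : Fin N => (a : ℕ)) hne
  simp only [Finset.mem_filter, Finset.mem_univ, true_and] at ha hmin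
  refine Finset.mem_image.2 ⟨(a, p.2), ?_, rfl⟩
  simp only [Finset.mem_filter, Finset.mem_univ, true_and]
  refine ⟨ha, ?_⟩
  rw [leftNbr]
  split_ifs with h
  · exact hzC
  · intro hmem
    have := hmin _ hmem
    simp only at this h
    omega

theorem card_columns_le {V : Type*} [DecidableEq V] {N : ℕ} {ι : Fin N × Fin N → V}
    {z : V} {C : Finset V} (hzC : z ∉ C) :
    ((Finset.univ.filter fun p => ι p ∈ C).image Prod.fst).card ≤
      (Finset.univ.filter fun p => ι p ∈ C ∧ lowerNbr ι z p ∉ C).card := by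
  refine le_trans (Finset.card_le_card ?_) (Finset.card_image_le (f := Prod.fst))
  intro a ha
  obtain ⟨p, hp, rfl⟩ := Finset.mem_image.1 ha
  have hne : (Finset.univ.filter fun b : Fin N => ι (p.1, b) ∈ C).Nonempty :=
    ⟨p.2, by simpa using hp⟩
  obtain ⟨b, hb, hmin⟩ := Finset.exists_min_image _ (fun b : Fin N => (b : ℕ)) hne
  simp only [Finset.mem_filter, Finset.mem_univ, true_and] at hb hmin
  refine Finset.mem_image.2 ⟨(p.1, b), ?_, rfl⟩
  simp only [Finset.mem_filter, Finset.mem_univ, true_and]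
  refine ⟨hb, ?_⟩
  rw [lowerNbr]
  split_ifs with h
  · exact hzC
  · intro hmem
    have := hmin _ hmem
    simp only at this h
    omega

/-- The `N × N` grid embedded by `ι`, its first column and its bottom row being joined to the
vertex `z`, and all vertices outside the grid being joined to `z`. -/
noncomputable def wiredGrid {V : Type*} [Fintype V] [DecidableEq V] {N : ℕ}
    (ι : Fin N × Fin N → V) (z : V) : CapGraph V :=
  CapGraph.ofEdges (Sum.elim ι (Sum.elim ι id))
    (Sum.elim (leftNbr ι z) (Sum.elim (lowerNbr ι z) (pendantNbr ι z)))

section WiredGrid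

variable {V : Type*} [Fintype V] [DecidableEq V] {N : ℕ} {ι : Fin N × Fin N → V} {z : V}

theorem wiredGrid_isConnected (hι : Function.Injective ι) (hz : z ∉ Set.range ι) :
    (wiredGrid ι z).IsConnected := by
  have hgrid : ∀ (a : ℕ) (ha : a < N) (b : Fin N),
      (wiredGrid ι z).toSimple.Reachable (ι (⟨a, ha⟩, b)) z := by
    intro a
    induction a with
    | zero =>
      intro ha b
      have h := CapGraph.ofEdges_adj (Sum.elim ι (Sum.elim ι id))
        (Sum.elim (leftNbr ι z) (Sum.elim (lowerNbr ι z) (pendantNbr ι z)))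
        (Sum.inl (⟨0, ha⟩, b)) (by
          simp only [Sum.elim_inl, leftNbr, if_true]
          exact fun h => hz ⟨_, h⟩)
      simp only [Sum.elim_inl, leftNbr, if_true] at h
      exact h.reachable
    | succ a ih =>
      intro ha b
      have h := CapGraph.ofEdges_adj (Sum.elim ι (Sum.elim ι id))
        (Sum.elim (leftNbr ι z) (Sum.elim (lowerNbr ι z) (pendantNbr ι z)))
        (Sum.inl (⟨a + 1, ha⟩, b)) (by
          simp only [Sum.elim_inl, leftNbr, Nat.add_eq_zero_iff, one_ne_zero, and_false, if_false]
          intro h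
          have := congrArg (fun p => (p.1 : ℕ)) (hι h)
          simp at this)
      simp only [Sum.elim_inl, leftNbr, Nat.add_eq_zero_iff, one_ne_zero, and_false, if_false,
        Nat.add_sub_cancel] at h
      exact h.reachable.trans (ih (by omega) b)
  have hall : ∀ v, (wiredGrid ι z).toSimple.Reachable v z := by
    intro v
    by_cases hv : v ∈ Set.range ι
    · obtain ⟨⟨a, b⟩, rfl⟩ := hv
      exact hgrid a a.2 b
    · by_cases hvz : v = z
      · rw [hvz]
      · have h := CapGraph.ofEdges_adj (Sum.elim ι (Sum.elim ι id))
          (Sum.elim (leftNbr ι z) (Sum.elim (lowerNbr ι z) (pendantNbr ι z)))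
          (Sum.inr (Sum.inr v)) (by simpa [pendantNbr, hv] using hvz)
        simp only [Sum.elim_inr, pendantNbr, if_neg hv] at h
        exact h.reachable
  have : Nonempty V := ⟨z⟩
  exact SimpleGraph.Connected.mk fun u v => (hall u).trans (hall v).symm

theorem card_crossing_le_cutCap (C : Finset V) :
    (Finset.univ.filter fun p => ι p ∈ C ∧ leftNbr ι z p ∉ C).card +
      (Finset.univ.filter fun p => ι p ∈ C ∧ lowerNbr ι z p ∉ C).card +
      (Finset.univ.filter fun v => v ∈ C ∧ pendantNbr ι z v ∉ C).card ≤
      (wiredGrid ι z).cutCap C := by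
  refine le_trans (le_of_eq ?_) (CapGraph.card_le_cutCap_ofEdges _ _ C)
  simp only [Finset.card_filter, Fintype.sum_sum_type, Sum.elim_inl, Sum.elim_inr, id, add_assoc]
  congr!

/-- Isoperimetry: a set avoiding `z` is contained in the product of its rows and columns, and each
of these contributes an edge to the cut. -/
theorem sqrt_gridCount_le_cutCap {C : Finset V} (hzC : z ∉ C) :
    √(gridCount ι C) ≤ ((wiredGrid ι z).cutCap C : ℝ) := by
  have h1 := card_rows_le (ι := ι) hzC
  have h2 := card_columns_le (ι := ι) hzC
  have h3 := card_crossing_le_cutCap (ι := ι) (z := z) C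
  have h4 := Finset.card_le_card (Finset.subset_product
    (s := Finset.univ.filter fun p : Fin N × Fin N => ι p ∈ C))
  rw [Finset.card_product] at h4
  refine Real.sqrt_le_left (Nat.cast_nonneg _) |>.2 ?_
  rw [gridCount]
  norm_cast
  refine h4.trans ((Nat.mul_le_mul h2 h1).trans ?_)
  rw [sq]
  exact Nat.mul_le_mul (by omega) (by omega)

theorem cutCap_wiredGrid_pos {C : Finset V} (hzC : z ∉ C)
    (hC : C.Nonempty) : 0 < (wiredGrid ι z).cutCap C := by
  obtain ⟨v, hv⟩ := hC
  by_cases hvr : v ∈ Set.range ι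
  · obtain ⟨p, rfl⟩ := hvr
    have h : 0 < gridCount ι C := Finset.card_pos.2 ⟨p, by simpa using hv⟩
    have h2 : 0 < √(gridCount ι C : ℝ) := Real.sqrt_pos.2 (by exact_mod_cast h)
    exact_mod_cast h2.trans_le (sqrt_gridCount_le_cutCap hzC)
  · have h : 0 < (Finset.univ.filter fun v => v ∈ C ∧ pendantNbr ι z v ∉ C).card := by
      refine Finset.card_pos.2 ⟨v, ?_⟩
      rw [Finset.mem_filter, pendantNbr, if_neg hvr]
      exact ⟨Finset.mem_univ _, hv, hzC⟩
    exact h.trans_le ((Nat.le_add_left _ _).trans (card_crossing_le_cutCap C))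

/-- A function on the grid, extended by zero, that changes by at most `1` along grid edges and is
at most `2N` has variation `O(N²)`: the `O(N)` edges at `z` contribute at most `2N` each. -/
theorem variation_wiredGrid_le (hι : Function.Injective ι) (hz : z ∉ Set.range ι)
    (g : Fin N × Fin N → ℝ) (hb : ∀ p, |g p| ≤ 2 * N)
    (hl : ∀ p q : Fin N × Fin N, (p.1 : ℕ) = q.1 + 1 → p.2 = q.2 → |g p - g q| ≤ 1)
    (hd : ∀ p q : Fin N × Fin N, p.1 = q.1 → (p.2 : ℕ) = q.2 + 1 → |g p - g q| ≤ 1) :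
    (wiredGrid ι z).variation (Function.extend ι g (0 : V → ℝ)) ≤ 2 * (6 * (N : ℝ) ^ 2) := by
  set F := Function.extend ι g (0 : V → ℝ) with hF
  have hFι : ∀ p, F (ι p) = g p := hι.extend_apply g (0 : V → ℝ)
  have hFz : F z = 0 := Function.extend_apply' g (0 : V → ℝ) z hz
  have hside : ∀ a : Fin N, ∑ b : Fin N, ((1 : ℝ) + if (b : ℕ) = 0 then 2 * (N : ℝ) else 0) ≤
      3 * N := by
    intro a
    have h : ∑ b : Fin N, (if (b : ℕ) = 0 then 2 * (N : ℝ) else 0) ≤ 2 * N := by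
      rw [← Finset.sum_filter, Finset.sum_const, nsmul_eq_mul]
      have : (Finset.univ.filter fun b : Fin N => (b : ℕ) = 0).card ≤ 1 := by
        refine Finset.card_le_one.2 fun x hx y hy => Fin.ext ?_
        rw [(Finset.mem_filter.1 hx).2, (Finset.mem_filter.1 hy).2]
      have h' : ((Finset.univ.filter fun b : Fin N => (b : ℕ) = 0).card : ℝ) ≤ 1 := by
        exact_mod_cast this
      nlinarith [(Nat.cast_nonneg N : (0 : ℝ) ≤ N)]
    rw [Finset.sum_add_distrib]
    simp only [Finset.sum_const, Finset.card_univ, Fintype.card_fin, nsmul_eq_mul, mul_one]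
    linarith
  have hleft : ∑ p, |F (ι p) - F (leftNbr ι z p)| ≤ 3 * (N : ℝ) ^ 2 := by
    have h : ∀ p : Fin N × Fin N, |F (ι p) - F (leftNbr ι z p)| ≤
        1 + if (p.1 : ℕ) = 0 then 2 * (N : ℝ) else 0 := by
      intro p
      rw [leftNbr]
      split_ifs with h0
      · rw [hFι, hFz, sub_zero]
        linarith [hb p]
      · rw [hFι, hFι, add_zero]
        exact hl _ _ (by simp only; omega) rfl
    refine (Finset.sum_le_sum fun p _ => h p).trans ?_
    rw [Fintype.sum_prod_type_right]
    refine (Finset.sum_le_sum fun a _ => hside a).trans (le_of_eq ?_)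
    simp; ring
  have hlower : ∑ p, |F (ι p) - F (lowerNbr ι z p)| ≤ 3 * (N : ℝ) ^ 2 := by
    have h : ∀ p : Fin N × Fin N, |F (ι p) - F (lowerNbr ι z p)| ≤
        1 + if (p.2 : ℕ) = 0 then 2 * (N : ℝ) else 0 := by
      intro p
      rw [lowerNbr]
      split_ifs with h0
      · rw [hFι, hFz, sub_zero]
        linarith [hb p]
      · rw [hFι, hFι, add_zero]
        exact hd _ _ rfl (by simp only; omega)
    refine (Finset.sum_le_sum fun p _ => h p).trans ?_
    rw [Fintype.sum_prod_type]
    refine (Finset.sum_le_sum fun a _ => hside a).trans (le_of_eq ?_)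
    simp; ring
  have hpend : ∑ v, |F v - F (pendantNbr ι z v)| = 0 := by
    refine Finset.sum_eq_zero fun v _ => ?_
    rw [pendantNbr]
    split_ifs with h
    · simp
    · rw [hFz, hF, Function.extend_apply' g (0 : V → ℝ) v h]
      simp
  refine (CapGraph.variation_ofEdges_le _ _ F).trans ?_
  simp only [Fintype.sum_sum_type, Sum.elim_inl, Sum.elim_inr, id]
  linarith

/-- The approximation guarantee of a hierarchical congestion approximator of the wired grid is at
least proportional to the number of dyadic scales. -/
theorem log_le_of_isHierarchical_wiredGrid (hN : N ≠ 0) (hι : Function.Injective ι)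
    (hz : z ∉ Set.range ι) {α : ℝ} {𝒞 : Set (Finset V)}
    (h : IsHierarchicalCongestionApproximator (wiredGrid ι z) α 𝒞) :
    ((Nat.log 2 N + 1 : ℕ) : ℝ) ≤ 456 * α := by
  classical
  set 𝓕 : Finset (Finset V) := (Set.toFinite (avoiding z 𝒞)).toFinset with h𝓕
  have hcoe : (𝓕 : Set (Finset V)) = avoiding z 𝒞 := by simp [h𝓕]
  have hmem : ∀ C ∈ 𝓕, z ∉ C ∧ C.Nonempty := fun C hC => by
    have : C ∈ avoiding z 𝒞 := by rwa [← hcoe]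
    exact ⟨this.1, this.2.1⟩
  have happ := h.2.avoiding z
  have hlam := h.1.avoiding z
  rw [← hcoe] at happ hlam
  have hNpos : (0 : ℝ) < N := by exact_mod_cast Nat.pos_of_ne_zero hN
  have hM : (0 : ℝ) < 6 * (N : ℝ) ^ 2 := by positivity
  have hlt : ∀ a : Fin N, ((a : ℕ) : ℝ) ≤ N := fun a => by exact_mod_cast a.2.le
  have hdec : ∀ g : Fin N × Fin N → ℝ, (∀ p, |g p| ≤ 2 * N) →
      (∀ p q : Fin N × Fin N, (p.1 : ℕ) = q.1 + 1 → p.2 = q.2 → |g p - g q| ≤ 1) →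
      (∀ p q : Fin N × Fin N, p.1 = q.1 → (p.2 : ℕ) = q.2 + 1 → |g p - g q| ≤ 1) →
      ∃ y : Finset V → ℝ, (∀ p, g p = ∑ C ∈ 𝓕 with ι p ∈ C, y C) ∧
        ∑ C ∈ 𝓕, |y C| * (wiredGrid ι z).cutCap C ≤ α * (6 * (N : ℝ) ^ 2) := by
    intro g hb hl hd
    obtain ⟨y, hy, hc⟩ := happ.exists_decomposition (fun C hC => (hmem C hC).1)
      (fun C hC => cutCap_wiredGrid_pos (hmem C hC).1 (hmem C hC).2)
      (Function.extend ι g (0 : V → ℝ)) (Function.extend_apply' g (0 : V → ℝ) z hz) hM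
      (variation_wiredGrid_le hι hz g hb hl hd)
    exact ⟨y, fun p => by rw [← hy, hι.extend_apply], hc⟩
  obtain ⟨y₁, hy₁, hc₁⟩ := hdec (fun p => (gridPos p).1)
    (fun p => by
      simp only [gridPos]
      rw [abs_of_nonneg (by positivity)]
      linarith [hlt p.1])
    (fun p q h1 h2 => by simp [gridPos, h1])
    (fun p q h1 h2 => by simp [gridPos, h1])
  obtain ⟨y₂, hy₂, hc₂⟩ := hdec (fun p => (gridPos p).2)
    (fun p => by
      simp only [gridPos]
      rw [abs_of_nonneg (by positivity)]
      linarith [hlt p.2])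
    (fun p q h1 h2 => by simp [gridPos, h2])
    (fun p q h1 h2 => by simp [gridPos, h2])
  have hmain := log_mul_sq_le_sum_sqrt hN ι 𝓕 hlam (fun C => (y₁ C, y₂ C)) fun p => by
    ext
    · rw [Prod.fst_sum]; exact hy₁ p
    · rw [Prod.snd_sum]; exact hy₂ p
  have hcost : ∑ C ∈ 𝓕, √(gridCount ι C) * (|y₁ C| + |y₂ C|) ≤ α * (12 * (N : ℝ) ^ 2) := by
    calc ∑ C ∈ 𝓕, √(gridCount ι C) * (|y₁ C| + |y₂ C|)
        ≤ ∑ C ∈ 𝓕, (|y₁ C| * (wiredGrid ι z).cutCap C +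
            |y₂ C| * (wiredGrid ι z).cutCap C) := by
          refine Finset.sum_le_sum fun C hC => ?_
          rw [← add_mul, mul_comm]
          exact mul_le_mul_of_nonneg_left (sqrt_gridCount_le_cutCap (hmem C hC).1)
            (by positivity)
      _ ≤ α * (12 * (N : ℝ) ^ 2) := by
          rw [Finset.sum_add_distrib]
          linarith
  have hsq : (0 : ℝ) < (N : ℝ) ^ 2 := by positivity
  refine le_of_mul_le_mul_right (hmain.trans ?_) hsq
  simp only
  linarith

end WiredGrid

/-! ### Graphs on any number of vertices -/

theorem mainTheorem9 :
    ∃ c : ℝ, 0 < c ∧ ∀ n : ℕ, 1 ≤ n →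
      ∃ G : CapGraph (Fin n), G.IsConnected ∧
        ∀ (α : ℝ) (𝒞 : Set (Finset (Fin n))),
          IsHierarchicalCongestionApproximator G α 𝒞 → c * Real.log (n : ℝ) ≤ α := by
  refine ⟨1 / 912, by norm_num, fun n hn => ?_⟩
  -- the largest grid that leaves room for `z`
  set N := Nat.sqrt (n - 1) with hNdef
  have hlow : N * N ≤ n - 1 := Nat.sqrt_le (n - 1)
  have hhigh : n - 1 < (N + 1) * (N + 1) := Nat.lt_succ_sqrt (n - 1)
  let ι : Fin N × Fin N → Fin n := fun p =>
    Fin.castLE (by omega : N * N ≤ n) (finProdFinEquiv p)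
  let z : Fin n := ⟨N * N, by omega⟩
  have hι : Function.Injective ι :=
    (Fin.castLE_injective _).comp finProdFinEquiv.injective
  have hz : z ∉ Set.range ι := by
    rintro ⟨p, hp⟩
    have h1 : ((finProdFinEquiv p : Fin (N * N)) : ℕ) = N * N := congrArg Fin.val hp
    exact absurd (finProdFinEquiv p).2 (by omega)
  refine ⟨wiredGrid ι z, wiredGrid_isConnected hι hz, fun α 𝒞 h => ?_⟩
  have hα : 1 ≤ α := h.2.1
  by_cases hN : N = 0
  · rw [hN] at hhigh
    have : n = 1 := by omega
    rw [this]
    simp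
    linarith
  have hlog := log_le_of_isHierarchical_wiredGrid hN hι hz h
  have hpow : N + 1 ≤ 2 ^ (Nat.log 2 N + 1) := Nat.lt_pow_succ_log_self (by norm_num) N
  have hn2 : n ≤ (2 ^ (Nat.log 2 N + 1)) ^ 2 := by
    rw [sq]
    exact le_trans (by omega) (Nat.mul_le_mul hpow hpow)
  have hlogn : Real.log n ≤ 2 * (Nat.log 2 N + 1 : ℕ) := by
    have h1 : Real.log n ≤ Real.log (((2 : ℝ) ^ (Nat.log 2 N + 1)) ^ 2) :=
      Real.log_le_log (by exact_mod_cast hn) (by exact_mod_cast hn2)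
    rw [Real.log_pow, Real.log_pow] at h1
    have h2 : Real.log 2 ≤ 1 := by linarith [Real.log_two_lt_d9]
    have h3 : (0 : ℝ) ≤ (Nat.log 2 N + 1 : ℕ) := Nat.cast_nonneg _
    calc Real.log n ≤ 2 * ((Nat.log 2 N + 1 : ℕ) * Real.log 2) := by exact_mod_cast h1
      _ ≤ 2 * (Nat.log 2 N + 1 : ℕ) := by
        linarith [mul_le_of_le_one_right h3 h2]
  linarith
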